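/- Conventions. Let $(\Omega,P)$ be a probability space and $L^2_0(\Omega)$ the Hilbert space of complex square integrable random variables with expectation zero. A generalized stochastic process (GSP) on $\mathbb R^d$ is a conjugate linear continuous map $u:C_c^\infty(\mathbb R^d)\to L^2_0(\Omega)$, $\varphi\mapsto(u,\varphi)$. It is wide-sense stationary (WSS) if $\mathbf E\big((u,T_x\varphi)\overline{(u,T_x\psi)}\big)=\mathbf E\big((u,\varphi)\overline{(u,\psi)}\big)$ for all test functions $\varphi,\psi$ and all $x\in\mathbb R^d$, where $T_x\varphi(y)=\varphi(y-x)$; two GSPs $u,w$ are uncorrelated if $\mathbf E\big((u,\varphi)\overline{(w,\psi)}\big)=0$ for all $\varphi,\psi$. With $\widehat\varphi(\xi)=(2\pi)^{-d/2}\int\varphi(x)e^{-i\langle x,\xi\rangle}\,dx$, the spectral measure of a WSS GSP $u$ is the non-negative Radon measure $\mu_u$ on $\mathbb R^d$ which is tempered ($\int(1+|\xi|^2)^{-s/2}\,d\mu_u<\infty$ for some $s\ge0$) and satisfies $\mathbf E\big((u,\varphi)\overline{(u,\psi)}\big)=\int\widehat\psi\,\overline{\widehat\varphi}\,d\mu_u$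 for all test functions. For a tempered measure $\mu$, $g\in L^\infty(\mu)$ is identified with the tempered distribution $\varphi\mapsto\int g\overline\varphi\,d\mu$, and $\mathscr FL^\infty(\mu)$ is the space of tempered distributions $f$ with $\widehat f\in L^\infty(\mu)$, that is $(f,\varphi)=\int\widehat f\,\overline{\widehat\varphi}\,d\mu$ for all Schwartz functions $\varphi$. $\mathscr FL^2(\mu)$ is the Hilbert space which the Fourier transform $\varphi\mapsto\widehat\varphi$ identifies isometrically with $L^2(\mu)$. Theorem. Let $u,w$ be uncorrelated WSS GSPs on $\mathbb R^d$ with spectral measures $\mu_u,\mu_w$, and let $v=u+w$, $\mu=\mu_u+\mu_w$. Then $u$ and $v$ extend by continuity to conjugate linear maps $\mathscr FL^2(\mu)\to L^2_0(\Omega)$. For $f\in\mathscr FL^\infty(\mu)$ define the filtered process by $(u_o,\varphi)=(v,F^*\varphi)$, $\widehat{F^*\varphi}=\overline{\widehat f}\,\widehat\varphi$, that is $F^*\varphi=(2\pi)^{-d/2}f^* *\varphi$, $\varphi\in\mathscr FL^2(\mu)$. There is exactly one $f\in\mathscr FL^\infty(\mu)$ which is mean square optimal, i.e. which minimizes $\mathbf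 E|(u,\varphi)-(u_o,\varphi)|^2$ over all filters in $\mathscr FL^\infty(\mu)$, for every $\varphi\in C_c^\infty(\mathbb R^d)$. It is $f=\mathscr F^{-1}\widehat f$, where $\widehat f=d\mu_u/d(\mu_u+\mu_w)$ is the Radon--Nikodym derivative: $\mu_u=\widehat f\,(\mu_u+\mu_w)$. Moreover $0\le\widehat f\le1$ $\mu$-a.e.; $\operatorname{ess\,supp}\widehat f=\operatorname{supp}\mu_u$, where $\operatorname{ess\,supp}\widehat f$ is the complement of the largest open set on which $\widehat f=0$ $\mu$-a.e.; and for every $\varphi\in\mathscr FL^2(\mu)$ the variable $(u_o,\varphi)$ belongs to the time domain $L^2_v(\Omega)=\overline{\{(v,\psi):\psi\in C_c^\infty(\mathbb R^d)\}}$ and is a best approximation of $(u,\varphi)$ in it, with minimal error $$J(\varphi)=\mathbf E|(u-u_o,\varphi)|^2=\int\widehat f\,|\widehat\varphi|^2\,d\mu_w=\int(1-\widehat f)\,|\widehat\varphi|^2\,d\mu_u .$$ -/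

import Mathlib

open MeasureTheory Filter Topology
open scoped ENNReal SchwartzMap Distributions ComplexConjugate FourierTransform

namespace WSSFilter

noncomputable section

/-- Euclidean space `ℝᵈ`. -/
abbrev E (d : ℕ) : Type := EuclideanSpace ℝ (Fin d)

/-- The space `C_c^∞(ℝᵈ)` of complex valued test functions, with its usual inductive limit
topology. -/
abbrev Test (d : ℕ) : Type := 𝓓((⊤ : TopologicalSpace.Opens (E d)), ℂ)

/-! ### Zero mean random variables of second order -/

section Probability

variable {Ω : Type*} [MeasurableSpace Ω]

/-- `L²₀(Ω)`: the square integrable complex random variables with expectation zero. -/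
def L20 (P : Measure Ω) [IsProbabilityMeasure P] : Submodule ℂ (Lp ℂ 2 P) where
  carrier := {X | ∫ ω, X ω ∂P = 0}
  zero_mem' := by
    simp
  add_mem' := by
    intro X Y hX hY
    have hX' : ∫ ω, X ω ∂P = 0 := hX
    have hY' : ∫ ω, Y ω ∂P = 0 := hY
    have h : ∫ ω, (X + Y) ω ∂P = ∫ ω, (X ω + Y ω) ∂P := integral_congr_ae (Lp.coeFn_add X Y)
    have h2 := integral_add ((Lp.memLp X).integrable (by norm_num))
      ((Lp.memLp Y).integrable (by norm_num))
    change ∫ ω, (X + Y) ω ∂P = 0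
    rw [h, h2, hX', hY', add_zero]
  smul_mem' := by
    intro c X hX
    have hX' : ∫ ω, X ω ∂P = 0 := hX
    have h : ∫ ω, (c • X) ω ∂P = ∫ ω, c • X ω ∂P := integral_congr_ae (Lp.coeFn_smul c X)
    change ∫ ω, (c • X) ω ∂P = 0
    rw [h, integral_smul, hX', smul_zero]

theorem mem_L20 {P : Measure Ω} [IsProbabilityMeasure P] {X : Lp ℂ 2 P} :
    X ∈ L20 P ↔ ∫ ω, X ω ∂P = 0 := Iff.rfl

theorem isClosed_L20 (P : Measure Ω) [IsProbabilityMeasure P] :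
    IsClosed (L20 P : Set (Lp ℂ 2 P)) := by
  have h : (L20 P : Set (Lp ℂ 2 P)) =
      {X | inner ℂ (indicatorConstLp 2 MeasurableSet.univ (measure_ne_top P _) (1 : ℂ)) X = 0} := by
    ext X
    simp only [SetLike.mem_coe, mem_L20, Set.mem_ofPred_eq, L2.inner_indicatorConstLp_one,
      setIntegral_univ]
  rw [h]
  exact isClosed_eq (by fun_prop) continuous_const

instance instCompleteSpaceL20 (P : Measure Ω) [IsProbabilityMeasure P] : CompleteSpace (L20 P) :=
  (isClosed_L20 P).completeSpace_coe

/-! ### Generalized stochastic processes -/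

/-- A (second order, zero mean) generalized stochastic process: a conjugate linear continuous map
`C_c^∞(ℝᵈ) → L²₀(Ω)`. -/
abbrev GSP (d : ℕ) (P : Measure Ω) [IsProbabilityMeasure P] : Type _ :=
  Test d →L⋆[ℂ] L20 P

variable {P : Measure Ω} [IsProbabilityMeasure P] {d : ℕ}

/-- `𝐄 (X * conj Y)`. -/
def cov (X Y : L20 P) : ℂ :=
  ∫ ω, (X : Lp ℂ 2 P) ω * conj ((Y : Lp ℂ 2 P) ω) ∂P

/-- The mean square error `𝐄 |X - Y|²`. -/
def mse (X Y : L20 P) : ℝ :=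
  ∫ ω, ‖(X : Lp ℂ 2 P) ω - (Y : Lp ℂ 2 P) ω‖ ^ 2 ∂P

/-- Two processes are uncorrelated if their cross-covariance distribution vanishes. -/
def Uncorrelated (u w : GSP d P) : Prop := ∀ φ ψ : Test d, cov (u φ) (w ψ) = 0

/-- The translate `T_x φ (y) = φ (y - x)` of a test function. -/
def translateTest (x : E d) (φ : Test d) : Test d where
  toFun y := φ (y - x)
  contDiff' := φ.contDiff.comp (contDiff_id.sub contDiff_const)
  hasCompactSupport' := by
    have h := φ.hasCompactSupport.comp_homeomorph (Homeomorph.addRight (-x))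
    simpa [Function.comp_def, sub_eq_add_neg] using h
  tsupport_subset' := by simp

/-- A process is wide-sense stationary if its covariance distribution is translation
invariant. -/
def IsWSS (u : GSP d P) : Prop :=
  ∀ (x : E d) (φ ψ : Test d),
    cov (u (translateTest x φ)) (u (translateTest x ψ)) = cov (u φ) (u ψ)

/-- The time domain `L²_v(Ω)`: the closure of the set of all `(v, φ)`. -/
def timeDomain (v : GSP d P) : Set (L20 P) := closure (Set.range v)

end Probability

/-! ### Tempered measures -/

/-- The sum of two tempered measures is tempered. -/
instance instHasTemperateGrowthAdd {d : ℕ} (μ ν : Measure (E d)) [hμ : μ.HasTemperateGrowth]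
    [hν : ν.HasTemperateGrowth] : (μ + ν).HasTemperateGrowth := by
  obtain ⟨m, hm⟩ := hμ.exists_integrable
  obtain ⟨n, hn⟩ := hν.exists_integrable
  have key : ∀ (k l : ℕ) (ρ : Measure (E d)), k ≤ l →
      Integrable (fun x : E d => (1 + ‖x‖) ^ (-(k : ℝ))) ρ →
      Integrable (fun x : E d => (1 + ‖x‖) ^ (-(l : ℝ))) ρ := by
    intro k l ρ hkl hk
    refine hk.mono' ((measurable_const.add measurable_norm).pow_const _).aestronglyMeasurable
      (Eventually.of_forall fun x => ?_)
    have hx : (1 : ℝ) ≤ 1 + ‖x‖ := by linarith [norm_nonneg x]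
    rw [Real.norm_of_nonneg (by positivity)]
    exact Real.rpow_le_rpow_of_exponent_le hx (by simpa using hkl)
  exact ⟨⟨max m n, (key m _ μ (le_max_left _ _) hm).add_measure
    (key n _ ν (le_max_right _ _) hn)⟩⟩

theorem isLocallyFiniteMeasure_of_hasTemperateGrowth {d : ℕ} (μ : Measure (E d))
    [hμ : μ.HasTemperateGrowth] : IsLocallyFiniteMeasure μ := by
  obtain ⟨n, hn⟩ := hμ.exists_integrable
  refine ⟨fun x => ⟨Metric.ball x 1, Metric.ball_mem_nhds x one_pos, ?_⟩⟩
  set c : ℝ := (2 + ‖x‖) ^ (-(n : ℝ)) with hc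
  have hc0 : 0 < c := by positivity
  have h := hn.measure_norm_ge_lt_top hc0
  refine (measure_mono fun y hy => ?_).trans_lt h
  have hxy : ‖y‖ ≤ ‖x‖ + 1 := by
    have h1 : ‖y - x‖ < 1 := by simpa [dist_eq_norm] using hy
    have h2 : ‖y‖ ≤ ‖y - x‖ + ‖x‖ := by simpa using norm_add_le (y - x) x
    linarith
  have h3 : 0 < 1 + ‖y‖ := by positivity
  change c ≤ ‖(1 + ‖y‖) ^ (-(n : ℝ))‖
  rw [Real.norm_of_nonneg (by positivity)]
  exact Real.rpow_le_rpow_of_nonpos h3 (by linarith) (by simp)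

/-! ### The Fourier transform -/

section Fourier

variable {d : ℕ}

/-- The dilation `ξ ↦ (2π)⁻¹ ξ`. -/
def dilation (d : ℕ) : E d ≃L[ℝ] E d :=
  ContinuousLinearEquiv.smulLeft (Units.mk0 ((2 * Real.pi)⁻¹ : ℝ) (by positivity))

theorem dilation_apply (ξ : E d) : dilation d ξ = (2 * Real.pi)⁻¹ • ξ := rfl

/-- The Fourier transform on the Schwartz space in the unitary normalization
`(2π)^{-d/2} ∫ f(x) e^{-i⟨x,ξ⟩} dx`; see `fourierS_apply`. It is obtained from Mathlib's transform,
whose exponential is `e^{-2πi⟨x,ξ⟩}`, by a dilation. -/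
def fourierS (d : ℕ) : 𝓢(E d, ℂ) →L[ℂ] 𝓢(E d, ℂ) :=
  (((2 * Real.pi) ^ (-(d : ℝ) / 2) : ℝ) : ℂ) •
    ((SchwartzMap.compCLMOfContinuousLinearEquiv ℂ (dilation d)).comp
      (SchwartzMap.fourierTransformCLM ℂ))

theorem fourierS_apply (φ : 𝓢(E d, ℂ)) (ξ : E d) :
    fourierS d φ ξ = (((2 * Real.pi) ^ (-(d : ℝ) / 2) : ℝ) : ℂ) *
      ∫ x, φ x * Complex.exp (-Complex.I * (inner ℝ x ξ : ℝ)) := by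
  have h : fourierS d φ ξ = (((2 * Real.pi) ^ (-(d : ℝ) / 2) : ℝ) : ℂ) *
      (𝓕 (φ : E d → ℂ)) ((2 * Real.pi)⁻¹ • ξ) := rfl
  rw [h, Real.fourier_eq']
  congr 1
  refine integral_congr_ae (Eventually.of_forall fun x => ?_)
  have hpi : (Real.pi : ℂ) ≠ 0 := by exact_mod_cast Real.pi_ne_zero
  simp only [inner_smul_right, smul_eq_mul]
  rw [mul_comm]
  congr 2
  push_cast
  field_simp

theorem fourierS_surjective : Function.Surjective (fourierS d) := by
  intro ψ
  have hc : (((2 * Real.pi) ^ (-(d : ℝ) / 2) : ℝ) : ℂ) ≠ 0 := by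
    have : (0 : ℝ) < (2 * Real.pi) ^ (-(d : ℝ) / 2) := by positivity
    exact_mod_cast this.ne'
  refine ⟨𝓕⁻ (SchwartzMap.compCLMOfContinuousLinearEquiv ℂ (dilation d).symm
    ((((2 * Real.pi) ^ (-(d : ℝ) / 2) : ℝ) : ℂ)⁻¹ • ψ)), ?_⟩
  ext ξ
  simp [fourierS, hc]

/-- A test function as a Schwartz function. -/
def toSchwartz : Test d →ₗ[ℂ] 𝓢(E d, ℂ) where
  toFun φ := φ.hasCompactSupport.toSchwartzMap φ.contDiff
  map_add' _ _ := rfl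
  map_smul' _ _ := rfl

theorem toSchwartz_apply (φ : Test d) (x : E d) : toSchwartz φ x = φ x := rfl

/-- The Fourier transform of a test function, as an element of `L²(μ)`, `μ` tempered. -/
def fourierL2 (μ : Measure (E d)) [μ.HasTemperateGrowth] : Test d →ₗ[ℂ] Lp ℂ 2 μ :=
  (SchwartzMap.toLpCLM ℂ ℂ 2 μ).toLinearMap ∘ₗ (fourierS d).toLinearMap ∘ₗ toSchwartz

/-- Tempered distributions, acting conjugate linearly on test functions. -/
abbrev TempDist (d : ℕ) : Type := 𝓢(E d, ℂ) →L⋆[ℂ] ℂ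

/-- The inverse Fourier transform `f = ℱ⁻¹ g ∈ 𝓢'(ℝᵈ)` of `g ∈ L^∞(μ)`, where `g` is identified
with the tempered distribution `g μ`: that is `(f, φ) = ∫ g * conj φ̂ dμ`;
see `invFourier_apply`. -/
def invFourier (μ : Measure (E d)) [μ.HasTemperateGrowth] (g : Lp ℂ ∞ μ) : TempDist d :=
  (starL ℂ : ℂ ≃L⋆[ℂ] ℂ).toContinuousLinearMap.comp
    (((Lp.toTemperedDistribution (star g) : 𝓢(E d, ℂ) →Lₚₜ[ℂ] ℂ) : 𝓢(E d, ℂ) →L[ℂ] ℂ).comp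
      (fourierS d))

theorem invFourier_apply (μ : Measure (E d)) [μ.HasTemperateGrowth] (g : Lp ℂ ∞ μ)
    (φ : 𝓢(E d, ℂ)) : invFourier μ g φ = ∫ ξ, g ξ * conj (fourierS d φ ξ) ∂μ := by
  have h : invFourier μ g φ =
      conj (Lp.toTemperedDistribution (star g) (fourierS d φ)) := rfl
  rw [h, Lp.toTemperedDistribution_apply, ← integral_conj]
  refine integral_congr_ae ?_
  filter_upwards [Lp.coeFn_star g] with ξ hξ
  rw [hξ]
  simp [mul_comm]

theorem invFourier_injective (μ : Measure (E d)) [μ.HasTemperateGrowth] :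
    Function.Injective (invFourier μ) := by
  have := isLocallyFiniteMeasure_of_hasTemperateGrowth μ
  intro g g' h
  have h1 : (Lp.toTemperedDistributionCLM ℂ μ ∞ (star g)) =
      (Lp.toTemperedDistributionCLM ℂ μ ∞ (star g')) := by
    ext ψ
    obtain ⟨φ, rfl⟩ := fourierS_surjective ψ
    have h2 : conj (Lp.toTemperedDistribution (star g) (fourierS d φ)) =
        conj (Lp.toTemperedDistribution (star g') (fourierS d φ)) := DFunLike.congr_fun h φ
    exact (starRingEnd ℂ).injective h2
  have h3 := LinearMap.ker_eq_bot.mp (Lp.ker_toTemperedDistributionCLM_eq_bot (F := ℂ)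
    (μ := μ) (p := ∞)) h1
  exact star_injective h3

/-- The space `ℱL^∞(μ)` of tempered distributions whose Fourier transform is in `L^∞(μ)`. -/
def FLinf (μ : Measure (E d)) [μ.HasTemperateGrowth] : Set (TempDist d) :=
  Set.range (invFourier μ)

/-- The Fourier transform `f̂ ∈ L^∞(μ)` of `f ∈ ℱL^∞(μ)`. -/
def hat (μ : Measure (E d)) [μ.HasTemperateGrowth] (f : TempDist d) : Lp ℂ ∞ μ :=
  Function.invFun (invFourier μ) f

theorem hat_invFourier (μ : Measure (E d)) [μ.HasTemperateGrowth] (g : Lp ℂ ∞ μ) :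
    hat μ (invFourier μ g) = g :=
  Function.leftInverse_invFun (invFourier_injective μ) g

theorem invFourier_hat (μ : Measure (E d)) [μ.HasTemperateGrowth] {f : TempDist d}
    (hf : f ∈ FLinf μ) : invFourier μ (hat μ f) = f :=
  Function.invFun_eq hf

/-- The essential support of a function with respect to a measure: the complement of the union of
all open sets on which the function vanishes almost everywhere. -/
def essSupport (μ : Measure (E d)) (g : E d → ℂ) : Set (E d) :=
  (⋃₀ {U | IsOpen U ∧ ∀ᵐ ξ ∂μ.restrict U, g ξ = 0})ᶜ

end Fourier

/-! ### Spectral measures and filters -/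

section Filtering

variable {Ω : Type*} [MeasurableSpace Ω] {P : Measure Ω} [IsProbabilityMeasure P] {d : ℕ}

/-- The tempered measure `μ` is the spectral measure of `u`:
`𝐄 ((u, φ) * conj (u, ψ)) = ∫ ψ̂ * conj φ̂ dμ` for all test functions. -/
def IsSpectralMeasure (u : GSP d P) (μ : Measure (E d)) [μ.HasTemperateGrowth] : Prop :=
  ∀ φ ψ : Test d, cov (u φ) (u ψ) =
    ∫ ξ, fourierS d (toSchwartz ψ) ξ * conj (fourierS d (toSchwartz φ) ξ) ∂μ

/-- The extension of a process `u` by continuity to `ℱL²(μ)`. The Hilbert space `ℱL²(μ)` is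
represented by its image `L²(μ)` under the Fourier transform, so this is the continuous conjugate
linear map `L²(μ) → L²₀(Ω)` that sends `φ̂` to `(u, φ)` for every test function `φ`. -/
def extend (u : GSP d P) (μ : Measure (E d)) [μ.HasTemperateGrowth] : Lp ℂ 2 μ →L⋆[ℂ] L20 P :=
  LinearMap.extendOfNorm (u : Test d →ₗ⋆[ℂ] L20 P) (fourierL2 μ)

/-- The process `v` filtered by convolution with `f ∈ ℱL^∞(μ)`:
`(u_o, φ) = (2π)^{-d/2} (v, f^* * φ)` for `φ ∈ ℱL²(μ)`. On the Fourier side,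
`(2π)^{-d/2} f^* * φ` is `conj f̂ * φ̂`, and `h` stands for `φ̂ ∈ L²(μ)`. -/
def filtered (v : GSP d P) (μ : Measure (E d)) [μ.HasTemperateGrowth] (f : TempDist d)
    (h : Lp ℂ 2 μ) : L20 P :=
  extend v μ ((star (hat μ f) • h : Lp ℂ 2 μ))

/-- The convolution filter `f ∈ ℱL^∞(μ)` applied to `v` is mean square error optimal for the
recovery of `u`: for every test function it has the least error among all such filters. -/
def IsOptimalFilter (u v : GSP d P) (μ : Measure (E d)) [μ.HasTemperateGrowth]
    (f : TempDist d) : Prop :=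
  f ∈ FLinf μ ∧ ∀ f' ∈ FLinf μ, ∀ φ : Test d,
    mse (u φ) (filtered v μ f (fourierL2 μ φ)) ≤ mse (u φ) (filtered v μ f' (fourierL2 μ φ))

end Filtering

end

end WSSFilter

/-!
The covariance of `u` is the `L²(μ_u)` inner product of the Fourier transforms, so `u` is bounded by
the norm of `L²(μ)`, `μ = μ_u + μ_w`; since `u` and `w` are uncorrelated, `v = u + w` has spectral
measure `μ` and is an isometry from `L²(μ)`. Both extend to `L²(μ)` because the Fourier transforms
of test functions are dense there (`denseRange_fourierL2`); this rests on the density of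
`C_c^∞` in the Schwartz space (`denseRange_toSchwartz`), proved by cutting off.

Let `g = dμ_u/dμ`, a function with values in `[0, 1]`. Uncorrelatedness also gives
`⟨(v, ψ), (u, φ)⟩ = ⟨(u, ψ), (u, φ)⟩`, and both are `⟨φ̂, g ψ̂⟩` in `L²(μ)`. Expanding the square
yields (`mse_extend_eq`)

  `𝐄 |(u, φ) - (v, ψ)|² = (⟨φ̂, g φ̂⟩ - ‖g φ̂‖²) + ‖ψ̂ - g φ̂‖²`.

Hence `ψ̂ = g φ̂` is optimal among all `ψ`, and by closedness in the whole time domain of `v`. The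
least error is `∫ g (1 - g) |φ̂|² dμ`, which is the integral of `(1 - g) |φ̂|²` over `μ_u = g μ` and
of `g |φ̂|²` over `μ_w = (1 - g) μ`. A filter with multiplier `f̂'` has excess error
`‖(conj f̂' - g) φ̂‖²`; if it vanishes for every test function, then `f̂' = g` by density
(`isOptimalFilter_iff`).
-/

namespace WSSFilter

/-! ### Density of the test functions -/

section Density

variable {d : ℕ}

/-- The Leibniz bound is uniform in the cutoff scale `a ∈ [0, 1]`: all seminorms of `χ(a ·) φ` are
bounded by those of `χ` and `φ`. -/
theorem exists_bound_cutoff_mul {χ : E d → ℝ} (hχ : ContDiff ℝ ((⊤ : ℕ∞) : WithTop ℕ∞) χ)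
    (hχc : HasCompactSupport χ) (φ : 𝓢(E d, ℂ)) (k n : ℕ) :
    ∃ C : ℝ, 0 ≤ C ∧ ∀ a : ℝ, 0 ≤ a → a ≤ 1 → ∀ x : E d,
      ‖x‖ ^ k * ‖iteratedFDeriv ℝ n (fun y => χ (a • y) • φ y) x‖ ≤ C := by
  set η : 𝓢(E d, ℝ) := hχc.toSchwartzMap hχ
  refine ⟨∑ i ∈ Finset.range (n + 1), (n.choose i : ℝ) * SchwartzMap.seminorm ℝ 0 i η *
    SchwartzMap.seminorm ℝ k (n - i) φ, by positivity, fun a ha0 ha1 x => ?_⟩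
  set A : E d →L[ℝ] E d := a • ContinuousLinearMap.id ℝ (E d)
  have hA : ‖A‖ ≤ 1 := by
    refine A.opNorm_le_bound zero_le_one fun y => ?_
    change ‖a • y‖ ≤ 1 * ‖y‖
    rw [norm_smul, Real.norm_of_nonneg ha0]
    gcongr
  have hχA (i : ℕ) : ‖iteratedFDeriv ℝ i (fun y => χ (a • y)) x‖ ≤
      SchwartzMap.seminorm ℝ 0 i η := by
    have h1 : iteratedFDeriv ℝ i (fun y => χ (a • y)) x =
        (iteratedFDeriv ℝ i χ (A x)).compContinuousLinearMap fun _ => A :=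
      A.iteratedFDeriv_comp_right hχ x (mod_cast le_top)
    rw [h1]
    refine (ContinuousMultilinearMap.norm_compContinuousLinearMap_le _ _).trans ?_
    have h2 : ∏ _i : Fin i, ‖A‖ ≤ 1 := Finset.prod_le_one (fun _ _ => norm_nonneg _) fun _ _ => hA
    exact (mul_le_of_le_one_right (norm_nonneg _) h2).trans
      (SchwartzMap.norm_iteratedFDeriv_le_seminorm ℝ η i (A x))
  have hs : ContDiff ℝ ((⊤ : ℕ∞) : WithTop ℕ∞) (fun y : E d => χ (a • y)) :=
    hχ.comp (contDiff_const_smul a)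
  have hL := norm_iteratedFDeriv_smul_le hs (φ.smooth ⊤) x (n := n) (mod_cast le_top)
  calc ‖x‖ ^ k * ‖iteratedFDeriv ℝ n (fun y => χ (a • y) • φ y) x‖
      ≤ ‖x‖ ^ k * ∑ i ∈ Finset.range (n + 1), (n.choose i : ℝ) *
          ‖iteratedFDeriv ℝ i (fun y => χ (a • y)) x‖ * ‖iteratedFDeriv ℝ (n - i) φ x‖ := by
        gcongr
    _ = ∑ i ∈ Finset.range (n + 1), (n.choose i : ℝ) *
          ‖iteratedFDeriv ℝ i (fun y => χ (a • y)) x‖ *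
            (‖x‖ ^ k * ‖iteratedFDeriv ℝ (n - i) φ x‖) := by
        rw [Finset.mul_sum]
        exact Finset.sum_congr rfl fun i _ => by ring
    _ ≤ _ := by
        gcongr with i _
        · exact hχA i
        · exact SchwartzMap.le_seminorm ℝ k (n - i) φ x

/-- The test function `χ(a ·) φ` obtained by cutting off a Schwartz function. -/
noncomputable def cutoff {χ : E d → ℝ} (hχ : ContDiff ℝ ((⊤ : ℕ∞) : WithTop ℕ∞) χ)
    (hχc : HasCompactSupport χ) (φ : 𝓢(E d, ℂ)) {a : ℝ} (ha : a ≠ 0) : Test d where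
  toFun y := χ (a • y) • φ y
  contDiff' := (hχ.comp (contDiff_const_smul a)).smul (φ.smooth ⊤)
  hasCompactSupport' := (hχc.comp_smul ha).smul_right
  tsupport_subset' := by simp

/-- The test functions are dense in the Schwartz space: `χ(· / N) φ → φ`, because the difference
vanishes on a ball of radius `N`, and off that ball a further factor `‖x‖ ≥ N` is available in the
bounded seminorms. -/
theorem denseRange_toSchwartz : DenseRange (toSchwartz (d := d)) := by
  intro φ
  let χ : ContDiffBump (0 : E d) := ⟨1, 2, one_pos, one_lt_two⟩
  have ha (N : ℕ) : ((N : ℝ) + 1)⁻¹ ≠ 0 := by positivity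
  refine mem_closure_of_tendsto (b := atTop)
    (f := fun N : ℕ => toSchwartz (cutoff χ.contDiff χ.hasCompactSupport φ (ha N))) ?_
    (Eventually.of_forall fun N => Set.mem_range_self _)
  rw [(schwartz_withSeminorms ℝ (E d) ℂ).tendsto_nhds]
  rintro ⟨k, n⟩ ε hε
  obtain ⟨C, hC0, hC⟩ := exists_bound_cutoff_mul χ.contDiff χ.hasCompactSupport φ (k + 1) n
  set D : ℝ := C + SchwartzMap.seminorm ℝ (k + 1) n φ
  have hD : 0 ≤ D := by positivity
  have hlim : Tendsto (fun N : ℕ => D * (1 / ((N : ℝ) + 1))) atTop (𝓝 0) := by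
    simpa using tendsto_one_div_add_atTop_nhds_zero_nat.const_mul D
  filter_upwards [hlim.eventually_lt_const hε] with N hN
  refine lt_of_le_of_lt ?_ hN
  set ψ : 𝓢(E d, ℂ) := toSchwartz (cutoff χ.contDiff χ.hasCompactSupport φ (ha N))
  have hψ : (ψ : E d → ℂ) = fun y => χ (((N : ℝ) + 1)⁻¹ • y) • φ y := rfl
  refine SchwartzMap.seminorm_le_bound ℝ k n _ (by positivity) fun x => ?_
  have hN0 : (0 : ℝ) < (N : ℝ) + 1 := by positivity
  have hsub : ((ψ - φ : 𝓢(E d, ℂ)) : E d → ℂ) = (ψ : E d → ℂ) - φ := by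
    ext y; simp
  rcases lt_or_ge ‖x‖ ((N : ℝ) + 1) with hx | hx
  · have hz : ((ψ - φ : 𝓢(E d, ℂ)) : E d → ℂ) =ᶠ[𝓝 x] fun _ => 0 := by
      filter_upwards [isOpen_lt continuous_norm continuous_const |>.mem_nhds hx] with y hy
      have h1 : χ (((N : ℝ) + 1)⁻¹ • y) = 1 := by
        refine χ.one_of_mem_closedBall ?_
        rw [mem_closedBall_zero_iff, norm_smul, norm_inv, Real.norm_of_nonneg hN0.le,
          inv_mul_le_iff₀ hN0]
        exact (le_of_lt hy).trans_eq (mul_one _).symm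
      rw [hsub, Pi.sub_apply, hψ]
      simp [h1]
    have h0 : iteratedFDeriv ℝ n ((ψ - φ : 𝓢(E d, ℂ)) : E d → ℂ) x = 0 := by
      rw [(hz.iteratedFDeriv ℝ n).eq_of_nhds]
      simp
    rw [h0, norm_zero, mul_zero]
    positivity
  · have h1 : ‖x‖ ^ (k + 1) * ‖iteratedFDeriv ℝ n ((ψ - φ : 𝓢(E d, ℂ)) : E d → ℂ) x‖ ≤ D := by
      rw [hsub, iteratedFDeriv_sub ((ψ.smooth ⊤).of_le (mod_cast le_top))
        ((φ.smooth ⊤).of_le (mod_cast le_top)), Pi.sub_apply]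
      calc _ ≤ ‖x‖ ^ (k + 1) * (‖iteratedFDeriv ℝ n ψ x‖ + ‖iteratedFDeriv ℝ n φ x‖) := by
            gcongr
            exact norm_sub_le _ _
        _ ≤ D := by
            rw [mul_add]
            refine add_le_add ?_ (SchwartzMap.le_seminorm ℝ (k + 1) n φ x)
            rw [hψ]
            refine hC _ (by positivity) ?_ x
            exact inv_le_one_of_one_le₀ (by linarith [N.cast_nonneg (α := ℝ)])
    rw [mul_one_div, le_div_iff₀ hN0]
    calc _ ≤ ‖x‖ ^ k * ‖iteratedFDeriv ℝ n ((ψ - φ : 𝓢(E d, ℂ)) : E d → ℂ) x‖ * ‖x‖ := by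
          gcongr
      _ = ‖x‖ ^ (k + 1) * ‖iteratedFDeriv ℝ n ((ψ - φ : 𝓢(E d, ℂ)) : E d → ℂ) x‖ := by ring
      _ ≤ D := h1

/-- The Fourier transforms of the test functions are dense in `L²(μ)`. -/
theorem denseRange_fourierL2 (μ : Measure (E d)) [μ.HasTemperateGrowth] :
    DenseRange (fourierL2 μ) := by
  have := isLocallyFiniteMeasure_of_hasTemperateGrowth μ
  have h1 : DenseRange (SchwartzMap.toLpCLM ℂ ℂ 2 μ : 𝓢(E d, ℂ) → Lp ℂ 2 μ) :=
    SchwartzMap.denseRange_toLpCLM (by norm_num)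
  have h2 : DenseRange (fun φ => SchwartzMap.toLpCLM ℂ ℂ 2 μ (fourierS d φ)) :=
    h1.comp fourierS_surjective.denseRange (SchwartzMap.toLpCLM ℂ ℂ 2 μ).continuous
  exact h2.comp denseRange_toSchwartz
    ((SchwartzMap.toLpCLM ℂ ℂ 2 μ).continuous.comp (fourierS d).continuous)

end Density

/-! ### The Radon–Nikodym derivative as a bounded multiplier -/

section Derivative

variable {α : Type*} [MeasurableSpace α] {ν μ : Measure α}

theorem toReal_rnDeriv_le_one [SigmaFinite μ] (h : ν ≤ μ) :
    ∀ᵐ x ∂μ, (ν.rnDeriv μ x).toReal ≤ 1 := by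
  filter_upwards [Measure.rnDeriv_le_one_of_le h] with x hx
  exact ENNReal.toReal_le_of_le_ofReal zero_le_one (by simpa using hx)

theorem memLp_top_rnDeriv [SigmaFinite μ] (h : ν ≤ μ) :
    MemLp (fun x => (((ν.rnDeriv μ x).toReal : ℝ) : ℂ)) ∞ μ := by
  refine memLp_top_of_bound (Complex.measurable_ofReal.comp
    (ν.measurable_rnDeriv μ).ennreal_toReal).aestronglyMeasurable 1 ?_
  filter_upwards [toReal_rnDeriv_le_one h] with x hx
  simpa using hx

/-- The Radon–Nikodym derivative `dν/dμ` as an element of `L^∞(μ)`; it is bounded by `1`, since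
`ν ≤ μ`. -/
noncomputable def densityLp [SigmaFinite μ] (h : ν ≤ μ) : Lp ℂ ∞ μ :=
  (memLp_top_rnDeriv h).toLp _

theorem coeFn_densityLp [SigmaFinite μ] (h : ν ≤ μ) :
    densityLp h =ᵐ[μ] fun x => (((ν.rnDeriv μ x).toReal : ℝ) : ℂ) :=
  MemLp.coeFn_toLp _

theorem star_densityLp [SigmaFinite μ] (h : ν ≤ μ) : star (densityLp h) = densityLp h := by
  refine Lp.ext ?_
  filter_upwards [Lp.coeFn_star (densityLp h), coeFn_densityLp h] with x hx hx'
  rw [hx, Pi.star_apply, hx']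
  simp

theorem coeFn_densityLp_smul [SigmaFinite μ] (h : ν ≤ μ) (k : Lp ℂ 2 μ) :
    (densityLp h • k : Lp ℂ 2 μ) =ᵐ[μ] fun x => (((ν.rnDeriv μ x).toReal : ℝ) : ℂ) * k x := by
  filter_upwards [Lp.coeFn_lpSMul (r := 2) (densityLp h) k, coeFn_densityLp h] with x hx hx'
  rw [hx, Pi.smul_apply', hx', smul_eq_mul]

/-- The sesquilinear form of multiplication by `dν/dμ` on `L²(μ)` is the inner product of `ν`. -/
theorem inner_densityLp_smul [SigmaFinite μ] [SigmaFinite ν] (h : ν ≤ μ) (k l : Lp ℂ 2 μ) :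
    inner ℂ k (densityLp h • l : Lp ℂ 2 μ) = ∫ x, l x * conj (k x) ∂ν := by
  rw [L2.inner_def, ← integral_rnDeriv_smul (Measure.absolutelyContinuous_of_le h)]
  refine integral_congr_ae ?_
  filter_upwards [coeFn_densityLp_smul h l] with x hx
  rw [hx, RCLike.inner_apply, Complex.real_smul, mul_assoc]

theorem inner_densityLp_smul_left [SigmaFinite μ] (h : ν ≤ μ) (k l : Lp ℂ 2 μ) :
    inner ℂ (densityLp h • k : Lp ℂ 2 μ) l = inner ℂ k (densityLp h • l : Lp ℂ 2 μ) := by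
  rw [L2.inner_def, L2.inner_def]
  refine integral_congr_ae ?_
  filter_upwards [coeFn_densityLp_smul h k, coeFn_densityLp_smul h l] with x hk hl
  simp only [hk, hl, RCLike.inner_apply, map_mul, Complex.conj_ofReal]
  ring

theorem continuous_lpSMul (g : Lp ℂ ∞ μ) : Continuous fun k : Lp ℂ 2 μ => (g • k : Lp ℂ 2 μ) :=
  ((ContinuousLinearMap.lsmul ℂ ℂ).holderL μ ∞ 2 2 g : Lp ℂ 2 μ →L[ℂ] Lp ℂ 2 μ).continuous

/-- A function in `L^∞` of a σ-finite measure is determined by the multiplication operator on `L²`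
that it defines. -/
theorem lpSMul_injective [SigmaFinite μ] {g g' : Lp ℂ ∞ μ}
    (h : ∀ k : Lp ℂ 2 μ, (g • k : Lp ℂ 2 μ) = g' • k) : g = g' := by
  refine Lp.ext ?_
  have key (n : ℕ) : ∀ᵐ x ∂μ, x ∈ spanningSets μ n → g x = g' x := by
    set k : Lp ℂ 2 μ := indicatorConstLp 2 (measurableSet_spanningSets μ n)
      (measure_spanningSets_lt_top μ n).ne (1 : ℂ)
    have h1 : (g • k : Lp ℂ 2 μ) =ᵐ[μ] (g' • k : Lp ℂ 2 μ) := by rw [h k]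
    filter_upwards [h1, Lp.coeFn_lpSMul (r := 2) g k, Lp.coeFn_lpSMul (r := 2) g' k,
      indicatorConstLp_coeFn_mem (p := 2) (hs := measurableSet_spanningSets μ n)
        (hμs := (measure_spanningSets_lt_top μ n).ne) (c := (1 : ℂ))] with x hx hg hg' hk hxn
    rw [hg, hg', Pi.smul_apply', Pi.smul_apply', hk hxn] at hx
    simpa using hx
  filter_upwards [ae_all_iff.2 key] with x hx
  exact hx _ (mem_spanningSetsIndex μ x)

/-- The error `⟨k, g k⟩ - ‖g k‖²` for `g = dν/dμ` is the integral of `(1 - g) |k|²` over `ν`. -/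
theorem re_inner_densityLp_sub [SigmaFinite μ] [SigmaFinite ν] (h : ν ≤ μ) (k : Lp ℂ 2 μ) :
    (inner ℂ k (densityLp h • k : Lp ℂ 2 μ)).re - ‖(densityLp h • k : Lp ℂ 2 μ)‖ ^ 2 =
      ∫ x, (1 - (ν.rnDeriv μ x).toReal) * ‖k x‖ ^ 2 ∂ν := by
  rw [@norm_sq_eq_re_inner ℂ, RCLike.re_eq_complex_re, inner_densityLp_smul_left, ← Complex.sub_re,
    ← inner_sub_right, L2.inner_def,
    ← integral_toReal_rnDeriv_mul (Measure.absolutelyContinuous_of_le h), ← Complex.ofReal_re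
      (∫ x, _ ∂μ), ← integral_complex_ofReal]
  congr 1
  refine integral_congr_ae ?_
  filter_upwards [coeFn_densityLp_smul h k, coeFn_densityLp_smul h (densityLp h • k : Lp ℂ 2 μ),
    Lp.coeFn_sub (densityLp h • k : Lp ℂ 2 μ) (densityLp h • (densityLp h • k : Lp ℂ 2 μ))]
    with x h1 h2 h3
  have h4 : k x * conj (k x) = ((‖k x‖ ^ 2 : ℝ) : ℂ) := by
    rw [Complex.mul_conj, Complex.normSq_eq_norm_sq]
  rw [h3, Pi.sub_apply, h2, h1, RCLike.inner_apply]
  push_cast at h4 ⊢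
  rw [← h4]
  ring

theorem integrable_bounded_mul_norm_sq [SigmaFinite μ] (k : Lp ℂ 2 μ) {c : α → ℝ}
    (hcm : AEStronglyMeasurable c μ) (hc : ∀ᵐ x ∂μ, ‖c x‖ ≤ 1) :
    Integrable (fun x => c x * ‖k x‖ ^ 2) μ :=
  ((Lp.memLp k).integrable_norm_pow two_ne_zero).bdd_mul hcm hc

end Derivative

section AddMeasure

variable {α : Type*} [MeasurableSpace α] {μ ν : Measure α} [SigmaFinite μ] [SigmaFinite ν]

theorem integrable_rnDeriv_mul_norm_sq (k : Lp ℂ 2 (μ + ν)) :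
    Integrable (fun x => (μ.rnDeriv (μ + ν) x).toReal * ‖k x‖ ^ 2) (μ + ν) := by
  refine integrable_bounded_mul_norm_sq k
    (μ.measurable_rnDeriv _).ennreal_toReal.aestronglyMeasurable ?_
  filter_upwards [toReal_rnDeriv_le_one (Measure.le_add_right le_rfl)] with x hx
  simpa using hx

theorem integrable_one_sub_rnDeriv_mul_norm_sq (k : Lp ℂ 2 (μ + ν)) :
    Integrable (fun x => (1 - (μ.rnDeriv (μ + ν) x).toReal) * ‖k x‖ ^ 2) (μ + ν) := by
  refine integrable_bounded_mul_norm_sq k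
    (measurable_const.sub (μ.measurable_rnDeriv _).ennreal_toReal).aestronglyMeasurable ?_
  filter_upwards [toReal_rnDeriv_le_one (Measure.le_add_right le_rfl)] with x hx
  rw [Real.norm_of_nonneg (by linarith)]
  linarith [ENNReal.toReal_nonneg (a := μ.rnDeriv (μ + ν) x)]

/-- Both sides are `∫ g (1 - g) |k|² d(μ + ν)` with `g = dμ/d(μ + ν)`. -/
theorem integral_one_sub_rnDeriv_mul_norm_sq (k : Lp ℂ 2 (μ + ν)) :
    ∫ x, (1 - (μ.rnDeriv (μ + ν) x).toReal) * ‖k x‖ ^ 2 ∂μ =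
      ∫ x, (μ.rnDeriv (μ + ν) x).toReal * ‖k x‖ ^ 2 ∂ν := by
  have hle : μ ≤ μ + ν := Measure.le_add_right le_rfl
  have hi := integrable_rnDeriv_mul_norm_sq k
  have hk := ((Lp.memLp k).integrable_norm_pow two_ne_zero).mono_measure hle
  have h1 := integral_add_measure (hi.mono_measure hle)
    (hi.mono_measure (Measure.le_add_left le_rfl))
  rw [integral_toReal_rnDeriv_mul (Measure.absolutelyContinuous_of_le hle)] at h1
  simp only [sub_mul, one_mul]
  rw [integral_sub hk (hi.mono_measure hle), h1]
  ring

end AddMeasure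

section Support

variable {d : ℕ}

/-- `dν/dμ` vanishes `μ`-a.e. on an open set exactly if `ν` does not charge it. -/
theorem essSupport_rnDeriv {ν μ : Measure (E d)} [SigmaFinite μ] [SigmaFinite ν] (h : ν ≪ μ)
    {g : E d → ℂ} (hg : g =ᵐ[μ] fun ξ => (((ν.rnDeriv μ ξ).toReal : ℝ) : ℂ)) :
    essSupport μ g = ν.support := by
  rw [← compl_compl ν.support, Measure.compl_support_eq_sUnion, essSupport]
  congr 2
  ext U
  refine and_congr_right fun hU => ?_
  have h1 : ν U = ∫⁻ ξ in U, ν.rnDeriv μ ξ ∂μ := by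
    rw [← withDensity_apply _ hU.measurableSet, Measure.withDensity_rnDeriv_eq _ _ h]
  rw [h1, lintegral_eq_zero_iff (ν.measurable_rnDeriv μ)]
  have h2 : ∀ᵐ ξ ∂μ.restrict U, g ξ = 0 ↔ ν.rnDeriv μ ξ = 0 := by
    filter_upwards [ae_restrict_of_ae hg, ae_restrict_of_ae (Measure.rnDeriv_lt_top ν μ)]
      with ξ h3 h4
    rw [h3, Complex.ofReal_eq_zero, ENNReal.toReal_eq_zero_iff]
    simp [h4.ne]
  exact eventually_congr h2

end Support

/-! ### Extension of the processes by continuity -/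

section Extension

variable {Ω : Type*} [MeasurableSpace Ω] {P : Measure Ω} [IsProbabilityMeasure P] {d : ℕ}

/-- `L20 P` also carries an `Inner` instance as a `CStarModule` over `ℂ`; the lemma fixes the one of
the inner product space. -/
theorem cov_eq_inner (X Y : L20 P) :
    cov X Y = @inner ℂ (L20 P) InnerProductSpace.toInner Y X := by
  rw [Submodule.coe_inner, L2.inner_def]
  rfl

theorem mse_eq_norm_sq (X Y : L20 P) : mse X Y = ‖X - Y‖ ^ 2 := by
  change mse X Y = ‖((X - Y : L20 P) : Lp ℂ 2 P)‖ ^ 2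
  rw [@norm_sq_eq_re_inner ℂ, L2.inner_def, RCLike.re_eq_complex_re,
    ← Complex.ofReal_re (mse X Y), mse, ← integral_complex_ofReal]
  congr 1
  refine integral_congr_ae ?_
  filter_upwards [Lp.coeFn_sub (X : Lp ℂ 2 P) Y] with ω hω
  rw [Submodule.coe_sub, hω, RCLike.inner_apply, Complex.mul_conj, Complex.normSq_eq_norm_sq,
    Pi.sub_apply]

theorem coeFn_fourierL2 (μ : Measure (E d)) [μ.HasTemperateGrowth] (φ : Test d) :
    fourierL2 μ φ =ᵐ[μ] fourierS d (toSchwartz φ) :=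
  (fourierS d (toSchwartz φ)).coeFn_toLp 2 μ

theorem inner_fourierL2 (μ : Measure (E d)) [μ.HasTemperateGrowth] (φ ψ : Test d) :
    inner ℂ (fourierL2 μ φ) (fourierL2 μ ψ) =
      ∫ ξ, fourierS d (toSchwartz ψ) ξ * conj (fourierS d (toSchwartz φ) ξ) ∂μ := by
  rw [L2.inner_def]
  refine integral_congr_ae ?_
  filter_upwards [coeFn_fourierL2 μ φ, coeFn_fourierL2 μ ψ] with ξ h1 h2
  rw [h1, h2, RCLike.inner_apply]

theorem IsSpectralMeasure.cov_eq_inner {u : GSP d P} {μ : Measure (E d)} [μ.HasTemperateGrowth]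
    (hu : IsSpectralMeasure u μ) (φ ψ : Test d) :
    cov (u φ) (u ψ) = inner ℂ (fourierL2 μ φ) (fourierL2 μ ψ) := by
  rw [hu, inner_fourierL2]

theorem IsSpectralMeasure.norm_eq {u : GSP d P} {μ : Measure (E d)} [μ.HasTemperateGrowth]
    (hu : IsSpectralMeasure u μ) (φ : Test d) : ‖u φ‖ = ‖fourierL2 μ φ‖ := by
  rw [@norm_eq_sqrt_re_inner ℂ, @norm_eq_sqrt_re_inner ℂ _ _ _ _ (fourierL2 μ φ),
    ← WSSFilter.cov_eq_inner, hu.cov_eq_inner]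

theorem norm_fourierL2_mono {ν μ : Measure (E d)} [ν.HasTemperateGrowth] [μ.HasTemperateGrowth]
    (h : ν ≤ μ) (φ : Test d) : ‖fourierL2 ν φ‖ ≤ ‖fourierL2 μ φ‖ := by
  rw [Lp.norm_def, Lp.norm_def, eLpNorm_congr_ae (coeFn_fourierL2 ν φ),
    eLpNorm_congr_ae (coeFn_fourierL2 μ φ)]
  exact ENNReal.toReal_mono (SchwartzMap.eLpNorm_lt_top _ 2 μ).ne (eLpNorm_mono_measure _ h)

theorem extend_fourierL2 {u : GSP d P} {ν μ : Measure (E d)} [ν.HasTemperateGrowth]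
    [μ.HasTemperateGrowth] (hu : IsSpectralMeasure u ν) (h : ν ≤ μ) (φ : Test d) :
    extend u μ (fourierL2 μ φ) = u φ := by
  refine LinearMap.extendOfNorm_eq (f := (u : Test d →ₗ⋆[ℂ] L20 P)) (denseRange_fourierL2 μ)
    ⟨1, fun φ => ?_⟩ φ
  rw [one_mul]
  exact (hu.norm_eq φ).trans_le (norm_fourierL2_mono h φ)

/-- An identity for the cross covariance of two processes extends from test functions to
`ℱL²(μ)`. -/
theorem cov_extend {a b : GSP d P} {μ : Measure (E d)} [μ.HasTemperateGrowth]
    (ha : ∀ φ, extend a μ (fourierL2 μ φ) = a φ) (hb : ∀ φ, extend b μ (fourierL2 μ φ) = b φ)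
    {T : Lp ℂ 2 μ → Lp ℂ 2 μ} (hT : Continuous T)
    (hab : ∀ φ ψ, cov (a φ) (b ψ) = inner ℂ (fourierL2 μ φ) (T (fourierL2 μ ψ)))
    (h k : Lp ℂ 2 μ) : cov (extend a μ h) (extend b μ k) = inner ℂ h (T k) := by
  refine (denseRange_fourierL2 μ).induction_on₂ (isClosed_eq ?_ ?_) (fun φ ψ => ?_) h k
  · simp only [cov_eq_inner]
    exact ((extend b μ).continuous.comp continuous_snd).inner
      ((extend a μ).continuous.comp continuous_fst)
  · exact continuous_fst.inner (hT.comp continuous_snd)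
  · rw [ha, hb, hab]

/-- The time domain contains all values of the extended process. -/
theorem extend_mem_timeDomain {v : GSP d P} {μ : Measure (E d)} [μ.HasTemperateGrowth]
    (hv : ∀ φ, extend v μ (fourierL2 μ φ) = v φ) (k : Lp ℂ 2 μ) :
    extend v μ k ∈ timeDomain v := by
  refine (denseRange_fourierL2 μ).induction_on (p := fun k => extend v μ k ∈ timeDomain v) k
    (isClosed_closure.preimage (extend v μ).continuous) fun φ => ?_
  rw [hv]
  exact subset_closure (Set.mem_range_self φ)

/-- If `w` is uncorrelated to `u`, the spectral measure of `u + w` is the sum of the spectral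
measures. -/
theorem IsSpectralMeasure.add {u w : GSP d P} {μ ν : Measure (E d)} [μ.HasTemperateGrowth]
    [ν.HasTemperateGrowth] (hu : IsSpectralMeasure u μ) (hw : IsSpectralMeasure w ν)
    (huw : Uncorrelated u w) : IsSpectralMeasure (u + w) (μ + ν) := by
  intro φ ψ
  have hint (ρ : Measure (E d)) [ρ.HasTemperateGrowth] :
      Integrable (fun ξ => fourierS d (toSchwartz ψ) ξ * conj (fourierS d (toSchwartz φ) ξ)) ρ := by
    refine (L2.integrable_inner (𝕜 := ℂ) (fourierL2 ρ φ) (fourierL2 ρ ψ)).congr ?_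
    filter_upwards [coeFn_fourierL2 ρ φ, coeFn_fourierL2 ρ ψ] with ξ h1 h2
    rw [h1, h2, RCLike.inner_apply]
  have h1 : cov (u φ) (w ψ) = 0 := huw φ ψ
  have h2 : cov (w φ) (u ψ) = 0 := by
    rw [WSSFilter.cov_eq_inner, inner_eq_zero_symm, ← WSSFilter.cov_eq_inner, huw]
  rw [integral_add_measure (hint μ) (hint ν), ← hu φ ψ, ← hw φ ψ]
  simp only [WSSFilter.cov_eq_inner] at h1 h2 ⊢
  simp only [_root_.add_apply, inner_add_left, inner_add_right, h1, h2, add_zero, zero_add]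

end Extension

/-! ### The error of an arbitrary filter -/

section Wiener

variable {Ω : Type*} [MeasurableSpace Ω] {P : Measure Ω} [IsProbabilityMeasure P] {d : ℕ}

/-- The error formula behind the theorem: with `g = dν/dμ`, approximating `(u, φ)` by `(v, ψ)`
costs `∫ (1 - g) |φ̂|² dν`, plus the squared distance of `ψ̂` to `g φ̂` in `L²(μ)`. -/
theorem mse_extend_eq {u v : GSP d P} {ν μ : Measure (E d)} [ν.HasTemperateGrowth]
    [μ.HasTemperateGrowth] [SigmaFinite ν] [SigmaFinite μ] (hle : ν ≤ μ)
    (hu : IsSpectralMeasure u ν) (hv : IsSpectralMeasure v μ)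
    (huv : ∀ φ ψ, cov (u φ) (v ψ) = cov (u φ) (u ψ)) (h k : Lp ℂ 2 μ) :
    mse (extend u μ h) (extend v μ k) = ∫ ξ, (1 - (ν.rnDeriv μ ξ).toReal) * ‖h ξ‖ ^ 2 ∂ν +
      ‖k - (densityLp hle • h : Lp ℂ 2 μ)‖ ^ 2 := by
  have eu := extend_fourierL2 hu hle
  have ev := extend_fourierL2 hv le_rfl
  have hg : Continuous fun k : Lp ℂ 2 μ => (densityLp hle • k : Lp ℂ 2 μ) := continuous_lpSMul _
  have huu0 (φ ψ : Test d) : cov (u φ) (u ψ) =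
      inner ℂ (fourierL2 μ φ) (densityLp hle • fourierL2 μ ψ : Lp ℂ 2 μ) := by
    rw [hu.cov_eq_inner, inner_densityLp_smul, inner_fourierL2]
    refine integral_congr_ae ?_
    have hac := Measure.absolutelyContinuous_of_le hle
    filter_upwards [hac.ae_eq (coeFn_fourierL2 μ φ), hac.ae_eq (coeFn_fourierL2 μ ψ)] with ξ h1 h2
    rw [h1, h2]
  have huu := cov_extend eu eu hg huu0 h h
  have huv' := cov_extend eu ev hg (fun φ ψ => (huv φ ψ).trans (huu0 φ ψ)) h k
  have hvv := cov_extend ev ev continuous_id hv.cov_eq_inner k k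
  rw [cov_eq_inner] at huu huv' hvv
  rw [mse_eq_norm_sq, ← re_inner_densityLp_sub hle, @norm_sub_sq ℂ, @norm_sub_sq ℂ _ _ _ _ k,
    @norm_sq_eq_re_inner ℂ _ _ _ _ (extend u μ h), @norm_sq_eq_re_inner ℂ _ _ _ _ (extend v μ k),
    @norm_sq_eq_re_inner ℂ _ _ _ _ k, huu, hvv,
    inner_re_symm (extend u μ h), huv', inner_re_symm k (densityLp hle • h : Lp ℂ 2 μ),
    inner_densityLp_smul_left]
  simp only [RCLike.re_eq_complex_re, id]
  ring

theorem filtered_invFourier_densityLp (v : GSP d P) {ν μ : Measure (E d)} [μ.HasTemperateGrowth]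
    [SigmaFinite μ] (hle : ν ≤ μ) (h : Lp ℂ 2 μ) :
    filtered v μ (invFourier μ (densityLp hle)) h =
      extend v μ (densityLp hle • h : Lp ℂ 2 μ) := by
  rw [filtered, hat_invFourier, star_densityLp]

theorem mse_filtered_densityLp {u v : GSP d P} {ν μ : Measure (E d)} [ν.HasTemperateGrowth]
    [μ.HasTemperateGrowth] [SigmaFinite ν] [SigmaFinite μ] (hle : ν ≤ μ)
    (hu : IsSpectralMeasure u ν) (hv : IsSpectralMeasure v μ)
    (huv : ∀ φ ψ, cov (u φ) (v ψ) = cov (u φ) (u ψ)) (h : Lp ℂ 2 μ) :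
    mse (extend u μ h) (filtered v μ (invFourier μ (densityLp hle)) h) =
      ∫ ξ, (1 - (ν.rnDeriv μ ξ).toReal) * ‖h ξ‖ ^ 2 ∂ν := by
  rw [filtered_invFourier_densityLp, mse_extend_eq hle hu hv huv, sub_self, norm_zero]
  ring

theorem mse_filtered_densityLp_le_extend {u v : GSP d P} {ν μ : Measure (E d)}
    [ν.HasTemperateGrowth] [μ.HasTemperateGrowth] [SigmaFinite ν] [SigmaFinite μ] (hle : ν ≤ μ)
    (hu : IsSpectralMeasure u ν) (hv : IsSpectralMeasure v μ)
    (huv : ∀ φ ψ, cov (u φ) (v ψ) = cov (u φ) (u ψ)) (h k : Lp ℂ 2 μ) :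
    mse (extend u μ h) (filtered v μ (invFourier μ (densityLp hle)) h) ≤
      mse (extend u μ h) (extend v μ k) := by
  rw [mse_filtered_densityLp hle hu hv huv, mse_extend_eq hle hu hv huv]
  exact le_add_of_nonneg_right (sq_nonneg _)

/-- The filter `dν/dμ` is optimal even among all elements of the time domain of `v`. -/
theorem mse_filtered_densityLp_le {u v : GSP d P} {ν μ : Measure (E d)}
    [ν.HasTemperateGrowth] [μ.HasTemperateGrowth] [SigmaFinite ν] [SigmaFinite μ] (hle : ν ≤ μ)
    (hu : IsSpectralMeasure u ν) (hv : IsSpectralMeasure v μ)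
    (huv : ∀ φ ψ, cov (u φ) (v ψ) = cov (u φ) (u ψ)) (h : Lp ℂ 2 μ) {X : L20 P}
    (hX : X ∈ timeDomain v) :
    mse (extend u μ h) (filtered v μ (invFourier μ (densityLp hle)) h) ≤
      mse (extend u μ h) X := by
  have hcl : IsClosed {X : L20 P |
      mse (extend u μ h) (filtered v μ (invFourier μ (densityLp hle)) h) ≤
        mse (extend u μ h) X} := by
    simp only [mse_eq_norm_sq]
    exact isClosed_le continuous_const (by fun_prop)
  refine closure_minimal ?_ hcl hX
  rintro _ ⟨φ, rfl⟩
  rw [← extend_fourierL2 hv le_rfl φ]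
  exact mse_filtered_densityLp_le_extend hle hu hv huv h _

/-- The excess of the error of a filter `f'` over the least error is `‖(conj f̂' - g) φ̂‖²`, with
`g = dν/dμ`. If it vanishes for all test functions `φ`, then `f̂' = g` by density. -/
theorem isOptimalFilter_iff {u v : GSP d P} {ν μ : Measure (E d)} [ν.HasTemperateGrowth]
    [μ.HasTemperateGrowth] [SigmaFinite ν] [SigmaFinite μ] (hle : ν ≤ μ)
    (hu : IsSpectralMeasure u ν) (hv : IsSpectralMeasure v μ)
    (huv : ∀ φ ψ, cov (u φ) (v ψ) = cov (u φ) (u ψ)) (f : TempDist d) :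
    IsOptimalFilter u v μ f ↔ f = invFourier μ (densityLp hle) := by
  have eu := extend_fourierL2 hu hle
  constructor
  · rintro ⟨hf, hopt⟩
    have hsm : star (hat μ f) = densityLp hle := by
      refine lpSMul_injective fun k => ?_
      refine congrFun ((denseRange_fourierL2 μ).equalizer (continuous_lpSMul _)
        (continuous_lpSMul _) (funext fun φ => ?_)) k
      have h1 := hopt _ (Set.mem_range_self (densityLp hle)) φ
      rw [← eu φ, mse_filtered_densityLp hle hu hv huv, filtered, mse_extend_eq hle hu hv huv,
        add_le_iff_nonpos_right] at h1
      exact sub_eq_zero.1 (norm_eq_zero.1 ((pow_eq_zero_iff two_ne_zero).1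
        (h1.antisymm (sq_nonneg _))))
    rw [← invFourier_hat μ hf, ← star_star (hat μ f), hsm, star_densityLp]
  · rintro rfl
    refine ⟨Set.mem_range_self (densityLp hle), fun f' _ φ => ?_⟩
    rw [← eu φ]
    exact mse_filtered_densityLp_le_extend hle hu hv huv _ _

end Wiener

end WSSFilter

open WSSFilter in
theorem theorem4 {Ω : Type*} [MeasurableSpace Ω] (P : Measure Ω) [IsProbabilityMeasure P] (d : ℕ)
    (u w : GSP d P) (hu : IsWSS u) (hw : IsWSS w) (huw : Uncorrelated u w)
    (μu μw : Measure (E d)) [μu.HasTemperateGrowth] [μw.HasTemperateGrowth]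
    (hμu : IsSpectralMeasure u μu) (hμw : IsSpectralMeasure w μw) :
    -- `u` and `v = u + w` extend by continuity to `ℱL²(μ_u + μ_w)`
    (∀ φ : Test d, extend u (μu + μw) (fourierL2 (μu + μw) φ) = u φ) ∧
    (∀ φ : Test d, extend (u + w) (μu + μw) (fourierL2 (μu + μw) φ) = u φ + w φ) ∧
    ∃ f : TempDist d,
      -- `f` is the unique optimal convolution filter
      (∀ f' : TempDist d, IsOptimalFilter u (u + w) (μu + μw) f' ↔ f' = f) ∧
      -- its Fourier transform is the Radon-Nikodym derivative
      f = invFourier (μu + μw) (hat (μu + μw) f) ∧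
      (hat (μu + μw) f =ᵐ[μu + μw] fun ξ => (((μu.rnDeriv (μu + μw) ξ).toReal : ℝ) : ℂ)) ∧
      μu = (μu + μw).withDensity (fun ξ => ENNReal.ofReal (hat (μu + μw) f ξ).re) ∧
      -- it takes values in `[0, 1]`
      (∀ᵐ ξ ∂(μu + μw), (hat (μu + μw) f ξ).im = 0 ∧ 0 ≤ (hat (μu + μw) f ξ).re ∧
        (hat (μu + μw) f ξ).re ≤ 1) ∧
      -- its essential support is the support of `μ_u`
      essSupport (μu + μw) (hat (μu + μw) f) = μu.support ∧
      -- for every `φ ∈ ℱL²(μ_u + μ_w)`, with Fourier transform `h`: the error is minimal, even among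
      -- all elements of the time domain of `v`, and has the stated value
      ∀ h : Lp ℂ 2 (μu + μw),
        filtered (u + w) (μu + μw) f h ∈ timeDomain (u + w) ∧
        (∀ X ∈ timeDomain (u + w),
          mse (extend u (μu + μw) h) (filtered (u + w) (μu + μw) f h) ≤
            mse (extend u (μu + μw) h) X) ∧
        Integrable (fun ξ => (hat (μu + μw) f ξ).re * ‖h ξ‖ ^ 2) μw ∧
        mse (extend u (μu + μw) h) (filtered (u + w) (μu + μw) f h) =
          ∫ ξ, (hat (μu + μw) f ξ).re * ‖h ξ‖ ^ 2 ∂μw ∧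
        Integrable (fun ξ => (1 - (hat (μu + μw) f ξ).re) * ‖h ξ‖ ^ 2) μu ∧
        mse (extend u (μu + μw) h) (filtered (u + w) (μu + μw) f h) =
          ∫ ξ, (1 - (hat (μu + μw) f ξ).re) * ‖h ξ‖ ^ 2 ∂μu := by
  have := isLocallyFiniteMeasure_of_hasTemperateGrowth μu
  have := isLocallyFiniteMeasure_of_hasTemperateGrowth μw
  have hle : μu ≤ μu + μw := Measure.le_add_right le_rfl
  have hle' : μw ≤ μu + μw := Measure.le_add_left le_rfl
  have hac : μu ≪ μu + μw := Measure.absolutelyContinuous_of_le hle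
  have hμv : IsSpectralMeasure (u + w) (μu + μw) := hμu.add hμw huw
  have ev := extend_fourierL2 hμv le_rfl
  have huv (φ ψ : Test d) : cov (u φ) ((u + w) ψ) = cov (u φ) (u ψ) := by
    have h := huw φ ψ
    rw [cov_eq_inner] at h ⊢
    rw [_root_.add_apply, inner_add_left, h, add_zero, cov_eq_inner]
  have hg := coeFn_densityLp hle
  have hre : (fun ξ => (densityLp hle ξ).re) =ᵐ[μu + μw]
      fun ξ => (μu.rnDeriv (μu + μw) ξ).toReal := by
    filter_upwards [hg] with ξ hξ
    rw [hξ, Complex.ofReal_re]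
  refine ⟨extend_fourierL2 hμu hle, ev, invFourier (μu + μw) (densityLp hle),
    isOptimalFilter_iff hle hμu hμv huv, ?_⟩
  rw [hat_invFourier]
  refine ⟨rfl, hg, ?_, ?_, essSupport_rnDeriv hac hg, fun h => ?_⟩
  · refine (Measure.withDensity_rnDeriv_eq μu (μu + μw) hac).symm.trans (withDensity_congr_ae ?_)
    filter_upwards [hre, Measure.rnDeriv_lt_top μu (μu + μw)] with ξ h1 h2
    rw [h1, ENNReal.ofReal_toReal h2.ne]
  · filter_upwards [hg, toReal_rnDeriv_le_one hle] with ξ h1 h2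
    rw [h1]
    exact ⟨Complex.ofReal_im _, ENNReal.toReal_nonneg, h2⟩
  · have hw1 : (fun ξ => (μu.rnDeriv (μu + μw) ξ).toReal * ‖h ξ‖ ^ 2) =ᵐ[μw]
        fun ξ => (densityLp hle ξ).re * ‖h ξ‖ ^ 2 := by
      filter_upwards [(Measure.absolutelyContinuous_of_le hle').ae_eq hre] with ξ hξ
      rw [hξ]
    have hu1 : (fun ξ => (1 - (μu.rnDeriv (μu + μw) ξ).toReal) * ‖h ξ‖ ^ 2) =ᵐ[μu]
        fun ξ => (1 - (densityLp hle ξ).re) * ‖h ξ‖ ^ 2 := by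
      filter_upwards [hac.ae_eq hre] with ξ hξ
      rw [hξ]
    refine ⟨?_, fun X hX => mse_filtered_densityLp_le hle hμu hμv huv h hX,
      ((integrable_rnDeriv_mul_norm_sq h).mono_measure hle').congr hw1, ?_,
      ((integrable_one_sub_rnDeriv_mul_norm_sq h).mono_measure hle).congr hu1, ?_⟩
    · rw [filtered_invFourier_densityLp]
      exact extend_mem_timeDomain ev _
    · rw [mse_filtered_densityLp hle hμu hμv huv, integral_one_sub_rnDeriv_mul_norm_sq,
        integral_congr_ae hw1]
    · rw [mse_filtered_densityLp hle hμu hμv huv, integral_congr_ae hu1]
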